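/- Let $d,n\ge 0$ be integers, let $\mathcal{S}$ be the vector space of real symmetric $d\times d$ matrices, let $\mathcal{D}\subset\mathcal{S}$ be the subspace of diagonal matrices, and let $F:\mathcal{S}\to\mathbf{R}$ be a function that is rotation-invariant, i.e. $F(gxg^{-1})=F(x)$ for every $x\in\mathcal{S}$ and every $d\times d$ rotation matrix $g$ (a real orthogonal matrix of determinant $1$). If the restriction of $F$ to $\mathcal{D}$ is $C^n$ ($n$ times continuously differentiable; continuous when $n=0$), then $F$ is $C^n$ on $\mathcal{S}$. -/

import Mathlib

/- Spaces of matrices carry the norm of the trace inner product `⟨x, y⟩ = tr (x yᵀ)`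
(all norms are equivalent here, so the choice does not affect differentiability). -/
attribute [local instance] Matrix.frobeniusNormedAddCommGroup Matrix.frobeniusNormedSpace

/-- The vector space of real symmetric `d × d` matrices. -/
def symMatrices (d : ℕ) : Submodule ℝ (Matrix (Fin d) (Fin d) ℝ) where
  carrier := {x | x.IsSymm}
  add_mem' hx hy := hx.add hy
  zero_mem' := Matrix.isSymm_zero
  smul_mem' c _ hx := hx.smul c

/-- The subspace of diagonal matrices in the space of symmetric matrices. -/
def diagMatrices (d : ℕ) : Submodule ℝ (symMatrices d) where
  carrier := {x | (x : Matrix (Fin d) (Fin d) ℝ).IsDiag}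
  add_mem' hx hy := hx.add hy
  zero_mem' := Matrix.isDiag_zero
  smul_mem' c _ hx := hx.smul c

/-- Conjugation `x ↦ g x g⁻¹` of symmetric matrices by a rotation matrix `g`
(an orthogonal matrix of determinant one). -/
def rotConj {d : ℕ} (g : Matrix.specialOrthogonalGroup (Fin d) ℝ) (x : symMatrices d) :
    symMatrices d :=
  ⟨(g : Matrix (Fin d) (Fin d) ℝ) * (x : Matrix (Fin d) (Fin d) ℝ) *
      ((g⁻¹ : Matrix.specialOrthogonalGroup (Fin d) ℝ) : Matrix (Fin d) (Fin d) ℝ), by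
    have hx : (x : Matrix (Fin d) (Fin d) ℝ).transpose = x := x.2
    have hg : ((g⁻¹ : Matrix.specialOrthogonalGroup (Fin d) ℝ) : Matrix (Fin d) (Fin d) ℝ) =
        (g : Matrix (Fin d) (Fin d) ℝ).transpose := rfl
    change Matrix.transpose _ = _
    rw [hg, Matrix.transpose_mul, Matrix.transpose_mul, Matrix.transpose_transpose, hx,
      Matrix.mul_assoc]⟩

/-- `F` is rotation-invariant: `F (g x g⁻¹) = F x` for all symmetric `x` and all rotations `g`. -/
def RotationInvariant {d : ℕ} (F : symMatrices d → ℝ) : Prop :=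
  ∀ (g : Matrix.specialOrthogonalGroup (Fin d) ℝ) (x : symMatrices d), F (rotConj g x) = F x

/-! On diagonal matrices `F` is a `C^n` function `f` of the eigenvalues, and invariance makes `f`
symmetric. Approximate `f` in `C^n` on a ball by symmetric polynomials
(`exists_isSymmetric_csmall_sub`). Each is a polynomial in the elementary symmetric ones, so it
extends to a smooth conjugation-invariant function of matrices through characteristic polynomial
coefficients (`MvPolynomial.IsSymmetric.exists_matrix_extension`). It remains to see that these
extensions are Cauchy in `C^n` on balls of symmetric matrices; their limit is `F`
(`contDiffOn_of_iteratedFDeriv_cauchy`).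

The heart is therefore an a priori estimate (`DerivFamily.csmall`): an invariant smooth function
that is `C^n`-small on diagonal matrices has all derivatives of order at most `n`, transversal ones
included, small there. With `ξ = E_ij - E_ji`, the function is constant along the field `x ↦ [ξ,
x]`, whose value at `diag v` is `(v_j - v_i)(E_ij + E_ji)`. Hence `v_j - v_i` times a transversal
derivative of order `k + 1` is a combination of derivatives of order `k`. Dividing by this linear
form costs one derivative along the diagonal (`CSmall.of_linear_mul`), so transversal order plus
diagonal order never exceeds `n`. Orthogonal conjugation is an isometry and carries the bounds from
diagonal to all symmetric matrices. -/

/-! ### Families small in `C^m`, and division by a linear form -/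

section SmallFamilies

open Filter Topology Set
open scoped ContDiff

variable {E ι : Type*} {l : Filter ι} {K : Set E}

/-- The family `u` tends to zero uniformly on `K` along `l`. -/
def UnifSmall (l : Filter ι) (K : Set E) (u : ι → E → ℝ) : Prop :=
  ∀ ε > 0, ∀ᶠ i in l, ∀ x ∈ K, |u i x| ≤ ε

theorem UnifSmall.add {u v : ι → E → ℝ} (hu : UnifSmall l K u) (hv : UnifSmall l K v) :
    UnifSmall l K (fun i x => u i x + v i x) := by
  intro ε hε
  filter_upwards [hu (ε / 2) (by positivity), hv (ε / 2) (by positivity)] with i h1 h2 x hx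
  have := abs_add_le (u i x) (v i x)
  linarith [h1 x hx, h2 x hx]

theorem UnifSmall.const_mul {u : ι → E → ℝ} (hu : UnifSmall l K u) (c : ℝ) :
    UnifSmall l K (fun i x => c * u i x) := by
  intro ε hε
  filter_upwards [hu (ε / (|c| + 1)) (by positivity)] with i h1 x hx
  rw [abs_mul]
  calc |c| * |u i x| ≤ (|c| + 1) * (ε / (|c| + 1)) := by
        gcongr
        · linarith
        · exact h1 x hx
    _ = ε := by field_simp

variable [NormedAddCommGroup E] [NormedSpace ℝ E]

/-- The directional derivative of `f` in the direction `v`. -/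
noncomputable def dirDeriv (v : E) (f : E → ℝ) : E → ℝ := fun x => fderiv ℝ f x v

/-- The family `u` and its directional derivatives of order at most `m` tend to zero uniformly
on `K` along `l`. -/
def CSmall (l : Filter ι) (K : Set E) : ℕ → (ι → E → ℝ) → Prop
  | 0, u => UnifSmall l K u
  | m + 1, u => UnifSmall l K u ∧ ∀ v, CSmall l K m (fun i => dirDeriv v (u i))

theorem CSmall.unifSmall {m : ℕ} {u : ι → E → ℝ} (h : CSmall l K m u) : UnifSmall l K u := by
  cases m with
  | zero => exact h
  | succ m => exact h.1

theorem CSmall.dirDeriv {m : ℕ} {u : ι → E → ℝ} (h : CSmall l K (m + 1) u) (v : E) :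
    CSmall l K m (fun i => dirDeriv v (u i)) := h.2 v

theorem CSmall.of_succ {m : ℕ} {u : ι → E → ℝ} (h : CSmall l K (m + 1) u) : CSmall l K m u := by
  induction m generalizing u with
  | zero => exact h.1
  | succ m ih => exact ⟨h.1, fun v => ih (h.2 v)⟩

theorem CSmall.of_le {m k : ℕ} (hkm : k ≤ m) {u : ι → E → ℝ} (h : CSmall l K m u) :
    CSmall l K k u := by
  induction hkm with
  | refl => exact h
  | step _ ih => exact ih h.of_succ

theorem dirDeriv_add {f g : E → ℝ} (hf : Differentiable ℝ f) (hg : Differentiable ℝ g) (v : E) :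
    dirDeriv v (fun x => f x + g x) = fun x => dirDeriv v f x + dirDeriv v g x := by
  ext x
  simp only [dirDeriv]
  rw [fderiv_fun_add (hf x) (hg x)]
  simp

theorem dirDeriv_const_mul {f : E → ℝ} (hf : Differentiable ℝ f) (c : ℝ) (v : E) :
    dirDeriv v (fun x => c * f x) = fun x => c * dirDeriv v f x := by
  ext x
  simp only [dirDeriv]
  rw [fderiv_const_mul (hf x)]
  simp

theorem ContDiff.dirDeriv {f : E → ℝ} {m : WithTop ℕ∞} (hf : ContDiff ℝ (m + 1) f) (v : E) :
    ContDiff ℝ m (dirDeriv v f) :=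
  (hf.fderiv_right le_rfl).clm_apply contDiff_const

theorem ContDiff.dirDeriv_infty {f : E → ℝ} (hf : ContDiff ℝ ∞ f) (v : E) :
    ContDiff ℝ ∞ (_root_.dirDeriv v f) :=
  ContDiff.dirDeriv (m := ∞) (by simpa using hf) v

theorem CSmall.add {m : ℕ} {u v : ι → E → ℝ} (hu : CSmall l K m u) (hv : CSmall l K m v)
    (hu' : ∀ i, ContDiff ℝ m (u i)) (hv' : ∀ i, ContDiff ℝ m (v i)) :
    CSmall l K m (fun i x => u i x + v i x) := by
  induction m generalizing u v with
  | zero => exact UnifSmall.add hu hv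
  | succ m ih =>
    refine ⟨hu.1.add hv.1, fun w => ?_⟩
    have h : ∀ i, _root_.dirDeriv w (fun x => u i x + v i x) =
        fun x => _root_.dirDeriv w (u i) x + _root_.dirDeriv w (v i) x := fun i =>
      dirDeriv_add ((hu' i).differentiable (by simp)) ((hv' i).differentiable (by simp)) w
    simp only [h]
    exact ih (hu.2 w) (hv.2 w) (fun i => (ContDiff.dirDeriv (by exact_mod_cast hu' i) w))
      (fun i => (ContDiff.dirDeriv (by exact_mod_cast hv' i) w))

theorem CSmall.const_mul {m : ℕ} {u : ι → E → ℝ} (hu : CSmall l K m u)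
    (hu' : ∀ i, ContDiff ℝ m (u i)) (c : ℝ) :
    CSmall l K m (fun i x => c * u i x) := by
  induction m generalizing u with
  | zero => exact UnifSmall.const_mul hu c
  | succ m ih =>
    refine ⟨hu.1.const_mul c, fun w => ?_⟩
    have h : ∀ i, _root_.dirDeriv w (fun x => c * u i x) =
        fun x => c * _root_.dirDeriv w (u i) x := fun i =>
      dirDeriv_const_mul ((hu' i).differentiable (by simp)) c w
    simp only [h]
    exact ih (hu.2 w) (fun i => (ContDiff.dirDeriv (by exact_mod_cast hu' i) w))

theorem CSmall.zero {m : ℕ} : CSmall l K m (fun (_ : ι) (_ : E) => (0 : ℝ)) := by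
  induction m with
  | zero => exact fun ε hε => .of_forall fun i x _ => by simpa using hε.le
  | succ m ih =>
    refine ⟨fun ε hε => .of_forall fun i x _ => by simpa using hε.le, fun v => ?_⟩
    have : _root_.dirDeriv v (fun _ : E => (0 : ℝ)) = fun _ => 0 := by
      ext x; simp [_root_.dirDeriv]
    simpa only [this] using ih

theorem CSmall.sum {m : ℕ} {κ : Type*} (s : Finset κ) {u : κ → ι → E → ℝ}
    (hu : ∀ k ∈ s, CSmall l K m (u k)) (hu' : ∀ k ∈ s, ∀ i, ContDiff ℝ m (u k i)) :
    CSmall l K m (fun i x => ∑ k ∈ s, u k i x) := by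
  classical
  induction s using Finset.induction_on with
  | empty => simpa using CSmall.zero
  | insert a s ha ih =>
    simp only [Finset.sum_insert ha]
    refine (hu a (by simp)).add (ih (fun k hk => hu k (by simp [hk]))
      (fun k hk => hu' k (by simp [hk]))) (hu' a (by simp)) fun i => ?_
    exact ContDiff.sum fun k hk => hu' k (by simp [hk]) i

/-- Agreement on `K` alone would not determine derivatives there, hence the open neighbourhood. -/
theorem CSmall.congr_of_isOpen {m : ℕ} {U : Set E} (hU : IsOpen U) (hKU : K ⊆ U)
    {u v : ι → E → ℝ} (huv : ∀ i, ∀ x ∈ U, u i x = v i x) (hu : CSmall l K m u) :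
    CSmall l K m v := by
  have h0 : UnifSmall l K v := by
    intro ε hε
    filter_upwards [hu.unifSmall ε hε] with i hi x hx
    rw [← huv i x (hKU hx)]
    exact hi x hx
  induction m generalizing u v with
  | zero => exact h0
  | succ m ih =>
    have h1 : ∀ w i, ∀ x ∈ U, _root_.dirDeriv w (u i) x = _root_.dirDeriv w (v i) x := by
      intro w i x hx
      have : u i =ᶠ[𝓝 x] v i := by
        filter_upwards [hU.mem_nhds hx] with y hy using huv i y hy
      simp only [_root_.dirDeriv, this.fderiv_eq]
    refine ⟨h0, fun w => ih (h1 w) (hu.2 w) ?_⟩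
    intro ε hε
    filter_upwards [(hu.2 w).unifSmall ε hε] with i hi x hx
    rw [← h1 w i x (hKU hx)]
    exact hi x hx

theorem CSmall.comp_tendsto {m : ℕ} {κ : Type*} {l' : Filter κ} {φ : κ → ι}
    (hφ : Tendsto φ l' l) {u : ι → E → ℝ} (hu : CSmall l K m u) :
    CSmall l' K m (fun k => u (φ k)) := by
  induction m generalizing u with
  | zero => exact fun ε hε => hφ.eventually (hu ε hε)
  | succ m ih => exact ⟨fun ε hε => hφ.eventually (hu.1 ε hε), fun v => ih (hu.2 v)⟩

theorem CSmall.comp_equiv {m : ℕ} (L : E ≃L[ℝ] E) (hL : ∀ x ∈ K, L x ∈ K)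
    {u : ι → E → ℝ} (hu : CSmall l K m u) :
    CSmall l K m (fun i x => u i (L x)) := by
  induction m generalizing u with
  | zero =>
    intro ε hε
    filter_upwards [hu ε hε] with i hi x hx using hi _ (hL x hx)
  | succ m ih =>
    refine ⟨?_, fun v => ?_⟩
    · intro ε hε
      filter_upwards [hu.1 ε hε] with i hi x hx using hi _ (hL x hx)
    · have h : ∀ i, _root_.dirDeriv v (fun x => u i (L x)) =
          fun x => _root_.dirDeriv (L v) (u i) (L x) := by
        intro i
        ext x
        have := L.comp_right_fderiv (f := u i) (x := x)
        simp only [_root_.dirDeriv]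
        change fderiv ℝ (u i ∘ L) x v = _
        rw [this]
        rfl
      simp only [h]
      exact ih (hu.2 (L v))

theorem dirDeriv_comm {f : E → ℝ} (hf : ContDiff ℝ ∞ f) (v w : E) :
    dirDeriv v (dirDeriv w f) = dirDeriv w (dirDeriv v f) := by
  ext x
  have h2 : ContDiff ℝ 2 f := hf.of_le (WithTop.coe_le_coe.2 le_top)
  have hs : IsSymmSndFDerivAt ℝ f x := h2.contDiffAt.isSymmSndFDerivAt (by simp)
  have hd : DifferentiableAt ℝ (fderiv ℝ f) x :=
    ((h2.fderiv_right (m := 1) (by norm_num)).differentiable (by simp)) x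
  have key : ∀ a b : E, dirDeriv a (dirDeriv b f) x = fderiv ℝ (fderiv ℝ f) x a b := by
    intro a b
    have h := hd.hasFDerivAt.clm_apply (hasFDerivAt_const b x)
    change fderiv ℝ (fun y => fderiv ℝ f y b) x a = _
    rw [h.fderiv]
    simp
  rw [key, key]
  exact hs v w

/-- The operator `ℓ ∂_w + c`. -/
noncomputable def eulerOp (ℓ : E →L[ℝ] ℝ) (w : E) (c : ℕ) (y : E → ℝ) : E → ℝ :=
  fun x => ℓ x * dirDeriv w y x + c * y x

variable {ℓ : E →L[ℝ] ℝ} {w : E}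

/-- The path `γ t = x - (1 - t) ℓ(x) w` runs from the hyperplane `ℓ = 0` to `x` with `ℓ (γ t) = t
ℓ(x)`. Along it `t^c y(γ t)` has derivative `t^(c-1) (ℓ ∂_w y + c y)(γ t)` and vanishes at `t = 0`
because `c ≥ 1`, so the mean value inequality gives the bound with no division by `ℓ`. -/
theorem abs_le_of_eulerOp_le (hw : ℓ w = 1)
    (hK : ∀ x ∈ K, ∀ t ∈ Icc (0 : ℝ) 1, x - ((1 - t) * ℓ x) • w ∈ K)
    {y : E → ℝ} (hy : Differentiable ℝ y) {c : ℕ} (hc : 1 ≤ c) {M : ℝ}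
    (hM : ∀ x ∈ K, |eulerOp ℓ w c y x| ≤ M) {x : E} (hx : x ∈ K) : |y x| ≤ M := by
  obtain ⟨c, rfl⟩ : ∃ k, c = k + 1 := ⟨c - 1, by omega⟩
  set γ : ℝ → E := fun t => x - ((1 - t) * ℓ x) • w with hγ
  have hγd : ∀ t, HasDerivAt γ (ℓ x • w) t := by
    intro t
    have h1 : HasDerivAt (fun t : ℝ => (1 - t) * ℓ x) (-ℓ x) t := by
      simpa using ((hasDerivAt_id t).const_sub 1).mul_const (ℓ x)
    simpa using (h1.smul_const w).const_sub x
  have hℓγ : ∀ t, ℓ (γ t) = t * ℓ x := by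
    intro t
    simp only [hγ, map_sub, map_smul, hw, smul_eq_mul]
    ring
  have hφ : ∀ t, HasDerivAt (fun t => t ^ (c + 1) * y (γ t))
      (t ^ c * eulerOp ℓ w (c + 1) y (γ t)) t := by
    intro t
    have h1 := (hasDerivAt_pow (c + 1) t).mul ((hy (γ t)).hasFDerivAt.comp_hasDerivAt t (hγd t))
    refine h1.congr_deriv ?_
    simp only [eulerOp, hℓγ, dirDeriv, map_smul, smul_eq_mul, Function.comp,
      add_tsub_cancel_right]
    push_cast
    ring
  have := norm_image_sub_le_of_norm_deriv_le_segment_01'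
    (fun t _ => (hφ t).hasDerivWithinAt) (C := M) ?_
  · simpa [hγ] using this
  · intro t ht
    have h1 := hM (γ t) (hK x hx t ⟨ht.1, ht.2.le⟩)
    rw [Real.norm_eq_abs, abs_mul, abs_of_nonneg (pow_nonneg ht.1 c)]
    calc t ^ c * |eulerOp ℓ w (c + 1) y (γ t)| ≤ 1 * |eulerOp ℓ w (c + 1) y (γ t)| := by
          gcongr
          exact pow_le_one₀ ht.1 ht.2.le
      _ ≤ M := by simpa using h1

theorem ContDiff.eulerOp {y : E → ℝ} (hy : ContDiff ℝ ∞ y) (c : ℕ) :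
    ContDiff ℝ ∞ (eulerOp ℓ w c y) :=
  (ℓ.contDiff.mul (hy.dirDeriv_infty w)).add (contDiff_const.mul hy)

theorem dirDeriv_eulerOp {y : E → ℝ} (hy : ContDiff ℝ ∞ y) (c : ℕ) (v : E) :
    dirDeriv v (eulerOp ℓ w c y) =
      fun x => eulerOp ℓ w c (dirDeriv v y) x + ℓ v * dirDeriv w y x := by
  have hd : Differentiable ℝ y := hy.differentiable (by simp)
  have hd' : Differentiable ℝ (dirDeriv w y) := (hy.dirDeriv_infty w).differentiable (by simp)
  ext x
  have h1 : HasFDerivAt (eulerOp ℓ w c y) (ℓ x • fderiv ℝ (dirDeriv w y) x +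
      dirDeriv w y x • ℓ + (c : ℝ) • fderiv ℝ y x) x :=
    ((ℓ.hasFDerivAt).mul (hd' x).hasFDerivAt).add ((hd x).hasFDerivAt.const_mul (c : ℝ))
  have h2 := congrFun (dirDeriv_comm hy v w) x
  have h3 : dirDeriv v (eulerOp ℓ w c y) x = ℓ x * dirDeriv v (dirDeriv w y) x +
      dirDeriv w y x * ℓ v + c * dirDeriv v y x := by
    rw [dirDeriv, h1.fderiv]
    simp [dirDeriv]
  rw [h3, h2, eulerOp]
  ring

/-- Commuting `∂_v` past `ℓ ∂_w + c` leaves the error `ℓ(v) ∂_w`. For `v = w` this only raises `c`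
to `c + 1`, so the induction must allow `c` to vary; for general `v` the error is then already
controlled. -/
theorem CSmall.of_eulerOp (hw : ℓ w = 1)
    (hK : ∀ x ∈ K, ∀ t ∈ Icc (0 : ℝ) 1, x - ((1 - t) * ℓ x) • w ∈ K) {m c : ℕ} (hc : 1 ≤ c)
    {y : ι → E → ℝ} (hy : ∀ i, ContDiff ℝ ∞ (y i))
    (h : CSmall l K m (fun i => eulerOp ℓ w c (y i))) : CSmall l K m y := by
  have h0 : ∀ (c : ℕ) (_ : 1 ≤ c) (y : ι → E → ℝ) (_ : ∀ i, ContDiff ℝ ∞ (y i)),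
      UnifSmall l K (fun i => eulerOp ℓ w c (y i)) → UnifSmall l K y := by
    intro c hc y hy h ε hε
    filter_upwards [h ε hε] with i hi x hx
    exact abs_le_of_eulerOp_le hw hK ((hy i).differentiable (by simp)) hc hi hx
  induction m generalizing c y with
  | zero => exact h0 c hc y hy h
  | succ m ih =>
    have hwy : CSmall l K m (fun i => _root_.dirDeriv w (y i)) := by
      refine ih (c := c + 1) (by omega) (fun i => (hy i).dirDeriv_infty w) ?_
      convert h.2 w using 2 with i
      rw [dirDeriv_eulerOp (hy i), hw]
      ext x
      simp only [_root_.eulerOp]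
      push_cast
      ring
    refine ⟨h0 c hc y hy h.1, fun v => ih hc (fun i => (hy i).dirDeriv_infty v) ?_⟩
    have hm : ((m : ℕ) : WithTop ℕ∞) ≤ ∞ := by exact_mod_cast le_top
    have := (h.2 v).add (hwy.const_mul (fun i => ((hy i).dirDeriv_infty w).of_le hm) (-ℓ v))
      (fun i => (((hy i).eulerOp c).dirDeriv_infty v).of_le hm)
      (fun i => (contDiff_const.mul ((hy i).dirDeriv_infty w)).of_le hm)
    convert this using 3 with i x
    rw [dirDeriv_eulerOp (hy i)]
    ring

/-- Quotients by a linear form lose one derivative. -/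
theorem CSmall.of_linear_mul (hw : ℓ w = 1)
    (hK : ∀ x ∈ K, ∀ t ∈ Icc (0 : ℝ) 1, x - ((1 - t) * ℓ x) • w ∈ K) {m : ℕ}
    {y : ι → E → ℝ} (hy : ∀ i, ContDiff ℝ ∞ (y i))
    (h : CSmall l K (m + 1) (fun i x => ℓ x * y i x)) : CSmall l K m y := by
  refine CSmall.of_eulerOp hw hK le_rfl hy ?_
  -- `∂_w (ℓ y) = ℓ ∂_w y + y`, the Euler operator with `c = 1`.
  convert h.2 w using 2 with i
  have hd : Differentiable ℝ (y i) := (hy i).differentiable (by simp)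
  ext x
  have h1 : HasFDerivAt (fun x => ℓ x * y i x) _ x := ℓ.hasFDerivAt.mul (hd x).hasFDerivAt
  rw [_root_.dirDeriv, h1.fderiv]
  simp [_root_.eulerOp, _root_.dirDeriv, hw]

end SmallFamilies

/-! ### Transversal derivatives of invariant families -/

section DerivFamilies

open Filter Topology Set
open scoped ContDiff

variable {E S ι : Type*} [NormedAddCommGroup E] [NormedSpace ℝ E] [NormedAddCommGroup S]
  [NormedSpace ℝ S]

/-- The linear span of the iterated directional derivatives of order `k` of a family `F`. -/
inductive DerivFamily (F : ι → S → ℝ) : ℕ → (ι → S → ℝ) → Prop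
  | base : DerivFamily F 0 F
  | zero (k : ℕ) : DerivFamily F k (fun _ _ => 0)
  | add {k : ℕ} {G H : ι → S → ℝ} : DerivFamily F k G → DerivFamily F k H →
      DerivFamily F k (fun i x => G i x + H i x)
  | const_mul {k : ℕ} {G : ι → S → ℝ} (c : ℝ) : DerivFamily F k G →
      DerivFamily F k (fun i x => c * G i x)
  | dirDeriv {k : ℕ} {G : ι → S → ℝ} (v : S) : DerivFamily F k G →
      DerivFamily F (k + 1) (fun i => dirDeriv v (G i))

variable {F : ι → S → ℝ}

theorem DerivFamily.contDiff (hF : ∀ i, ContDiff ℝ ∞ (F i)) {k : ℕ} {G : ι → S → ℝ}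
    (hG : DerivFamily F k G) (i : ι) : ContDiff ℝ ∞ (G i) := by
  induction hG with
  | base => exact hF i
  | zero => exact contDiff_const
  | add _ _ h1 h2 => exact h1.add h2
  | const_mul c _ h => exact contDiff_const.mul h
  | dirDeriv v _ h => exact h.dirDeriv_infty v

/-- The derivative along the linear vector field `A` preserves the derivative families of an
`A`-invariant family. -/
theorem DerivFamily.fderiv_apply (hF : ∀ i, ContDiff ℝ ∞ (F i)) (A : S →L[ℝ] S)
    (hA : ∀ i x, fderiv ℝ (F i) x (A x) = 0) {k : ℕ} {G : ι → S → ℝ} (hG : DerivFamily F k G) :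
    DerivFamily F k (fun i x => fderiv ℝ (G i) x (A x)) := by
  induction hG with
  | base => simpa only [hA] using DerivFamily.zero 0
  | zero k => simpa using DerivFamily.zero k
  | add h1 h2 ih1 ih2 =>
    refine (congrArg _ ?_).mp (ih1.add ih2)
    ext i x
    rw [fderiv_fun_add ((h1.contDiff hF i).differentiable (by simp) x)
      ((h2.contDiff hF i).differentiable (by simp) x)]
    simp
  | const_mul c h ih =>
    refine (congrArg _ ?_).mp (ih.const_mul c)
    ext i x
    rw [fderiv_const_mul ((h.contDiff hF i).differentiable (by simp) x)]
    simp
  | @dirDeriv k G v h ih =>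
    -- For the linear field `A`, `∂_A ∂_v G = ∂_v (∂_A G) - ∂_{A v} G`, so the order does not rise.
    refine (congrArg _ ?_).mp ((ih.dirDeriv v).add ((h.dirDeriv (A v)).const_mul (-1)))
    ext i x
    have hc := h.contDiff hF i
    have h2 : ContDiff ℝ 2 (G i) := hc.of_le (WithTop.coe_le_coe.2 le_top)
    have hs : IsSymmSndFDerivAt ℝ (G i) x := h2.contDiffAt.isSymmSndFDerivAt (by simp)
    have hd : HasFDerivAt (fderiv ℝ (G i)) (fderiv ℝ (fderiv ℝ (G i)) x) x :=
      (((h2.fderiv_right (m := 1) (by norm_num)).differentiable (by simp)) x).hasFDerivAt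
    have e1 : fderiv ℝ (fun y => fderiv ℝ (G i) y (A y)) x v =
        fderiv ℝ (fderiv ℝ (G i)) x v (A x) + fderiv ℝ (G i) x (A v) := by
      rw [(hd.clm_apply A.hasFDerivAt).fderiv]
      simp [add_comm]
    have e2 : fderiv ℝ (_root_.dirDeriv v (G i)) x (A x) =
        fderiv ℝ (fderiv ℝ (G i)) x (A x) v := by
      change fderiv ℝ (fun y => fderiv ℝ (G i) y v) x (A x) = _
      rw [(hd.clm_apply (hasFDerivAt_const v x)).fderiv]
      simp
    change _ = fderiv ℝ (_root_.dirDeriv v (G i)) x (A x)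
    change fderiv ℝ (fun y => fderiv ℝ (G i) y (A y)) x v + -1 * fderiv ℝ (G i) x (A v) = _
    rw [e1, e2, hs (A x) v]
    ring

variable {l : Filter ι} {K : Set E}

/-- If `F` is invariant under enough linear vector fields, then the smallness of `F` on the range
of `D` to order `n` propagates to the transversal derivatives of order at most `n`. -/
theorem DerivFamily.csmall (hF : ∀ i, ContDiff ℝ ∞ (F i)) (D : E →L[ℝ] S) {B : Set S}
    (hB : Submodule.span ℝ B = ⊤)
    (hBD : ∀ b ∈ B, (∃ e, D e = b) ∨ ∃ (A : S →L[ℝ] S) (ℓ : E →L[ℝ] ℝ) (w : E), ℓ w = 1 ∧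
      (∀ x ∈ K, ∀ t ∈ Icc (0 : ℝ) 1, x - ((1 - t) * ℓ x) • w ∈ K) ∧
      (∀ i x, fderiv ℝ (F i) x (A x) = 0) ∧ ∀ e, A (D e) = ℓ e • b)
    {n : ℕ} (h : CSmall l K n (fun i e => F i (D e))) (k : ℕ) :
    ∀ (m : ℕ) (G : ι → S → ℝ), k + m ≤ n → DerivFamily F k G →
      CSmall l K m (fun i e => G i (D e)) := by
  induction k using Nat.strong_induction_on with
  | _ k IH =>
  intro m G hkm hG
  have hm : ((m : ℕ) : WithTop ℕ∞) ≤ ∞ := by exact_mod_cast le_top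
  induction hG with
  | base => exact h.of_le (by omega)
  | zero => exact CSmall.zero
  | add h1 h2 ih1 ih2 =>
    exact (ih1 IH hkm).add (ih2 IH hkm) (fun i => ((h1.contDiff hF i).of_le hm).comp D.contDiff)
      (fun i => ((h2.contDiff hF i).of_le hm).comp D.contDiff)
  | const_mul c h1 ih1 =>
    exact (ih1 IH hkm).const_mul (fun i => ((h1.contDiff hF i).of_le hm).comp D.contDiff) c
  | @dirDeriv k G v hG _ =>
    have hGc := hG.contDiff hF
    have hv : v ∈ Submodule.span ℝ B := hB ▸ Submodule.mem_top
    have hcD : ∀ v i, ContDiff ℝ ∞ (fun e => _root_.dirDeriv v (G i) (D e)) := fun v i =>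
      ((hGc i).dirDeriv_infty v).comp D.contDiff
    -- Linearity in `v` reduces to `v ∈ B`: either tangent to the range of `D`, or transversal and
    -- reached by an invariant field.
    induction hv using Submodule.span_induction with
    | mem b hb =>
      rcases hBD b hb with ⟨e, rfl⟩ | ⟨A, ℓ, w, hw, hK, hA, hAD⟩
      · convert (IH k (by omega) (m + 1) G (by omega) hG).dirDeriv e using 2 with i
        ext x
        have h1 : HasFDerivAt (fun e => G i (D e)) _ x :=
          ((hGc i).differentiable (by simp) (D x)).hasFDerivAt.comp x D.hasFDerivAt
        change _ = fderiv ℝ (fun e => G i (D e)) x e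
        rw [h1.fderiv]
        rfl
      -- On the range of `D`, `ℓ ∂_b G = ∂_A G`, again of order `k`; the induction hypothesis at `m
      -- + 1` pays for the division by `ℓ`.
      · refine CSmall.of_linear_mul hw hK (hcD b) ?_
        convert IH k (by omega) (m + 1) _ (by omega) (hG.fderiv_apply hF A hA) using 3 with i x
        rw [hAD, map_smul, smul_eq_mul]
        rfl
    | zero => simpa [_root_.dirDeriv] using CSmall.zero
    | add v w _ _ hv hw =>
      simpa only [_root_.dirDeriv, map_add] using
        hv.add hw (fun i => (hcD v i).of_le hm) (fun i => (hcD w i).of_le hm)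
    | smul c v _ hv =>
      simpa only [_root_.dirDeriv, map_smul, smul_eq_mul] using
        hv.const_mul (fun i => (hcD v i).of_le hm) c

theorem DerivFamily.iteratedFDeriv (hF : ∀ i, ContDiff ℝ ∞ (F i)) (k : ℕ) (v : Fin k → S) :
    DerivFamily F k (fun i x => iteratedFDeriv ℝ k (F i) x v) := by
  induction k with
  | zero => simpa using DerivFamily.base
  | succ k ih =>
    refine (congrArg _ ?_).mp ((ih (Fin.tail v)).dirDeriv (v 0))
    ext i x
    have hd : DifferentiableAt ℝ (_root_.iteratedFDeriv ℝ k (F i)) x :=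
      (hF i).differentiable_iteratedFDeriv (by exact_mod_cast WithTop.coe_lt_top k) x
    rw [hd.iteratedFDeriv_succ_apply_left']
    rfl

/-- The norm of a multilinear form is controlled by its values on a basis. -/
theorem exists_norm_multilinear_le {κ : Type*} [Fintype κ] [FiniteDimensional ℝ S]
    (b : Module.Basis κ ℝ S) (k : ℕ) :
    ∃ C : ℝ, 0 < C ∧ ∀ (T : ContinuousMultilinearMap ℝ (fun _ : Fin k => S) ℝ) (ε : ℝ), 0 ≤ ε →
      (∀ r : Fin k → κ, |T (fun j => b (r j))| ≤ ε) → ‖T‖ ≤ C * ε := by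
  classical
  obtain ⟨M, hM0, hM⟩ : ∃ M : ℝ, 0 < M ∧ ∀ a v, |b.repr v a| ≤ M * ‖v‖ := by
    have h : ∀ a, ∃ M : ℝ, 0 < M ∧ ∀ v, |b.repr v a| ≤ M * ‖v‖ := fun a => by
      obtain ⟨M, h1, h2⟩ := (LinearMap.toContinuousLinearMap (b.coord a)).bound
      exact ⟨M, h1, h2⟩
    choose M hM1 hM2 using h
    refine ⟨∑ a, M a + 1, ?_, fun a v => (hM2 a v).trans ?_⟩
    · have := Finset.sum_nonneg fun a (_ : a ∈ Finset.univ) => (hM1 a).le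
      linarith
    · gcongr
      have := Finset.single_le_sum (fun a _ => (hM1 a).le) (Finset.mem_univ a)
      linarith
  -- The `+ 1` keeps the constant positive when there are no index tuples.
  refine ⟨Fintype.card (Fin k → κ) * M ^ k + 1, by positivity, fun T ε hε hT => ?_⟩
  refine ContinuousMultilinearMap.opNorm_le_bound (by positivity) fun v => ?_
  have h1 : T v = ∑ r : Fin k → κ, (∏ j, b.repr (v j) (r j)) * T (fun j => b (r j)) := by
    conv_lhs => rw [show v = fun j => ∑ a, b.repr (v j) a • b a from
      funext fun j => (b.sum_repr (v j)).symm]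
    rw [ContinuousMultilinearMap.map_sum]
    refine Finset.sum_congr rfl fun r _ => ?_
    rw [ContinuousMultilinearMap.map_smul_univ, smul_eq_mul]
  rw [h1]
  calc ‖∑ r : Fin k → κ, (∏ j, b.repr (v j) (r j)) * T (fun j => b (r j))‖
      ≤ ∑ r : Fin k → κ, (∏ j, (M * ‖v j‖)) * ε := by
        refine norm_sum_le_of_le _ fun r _ => ?_
        rw [Real.norm_eq_abs, abs_mul, Finset.abs_prod]
        gcongr with j
        · exact hM _ _
        · exact hT r
    _ = Fintype.card (Fin k → κ) * M ^ k * ε * ∏ j, ‖v j‖ := by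
        rw [Finset.sum_const, Finset.prod_mul_distrib, Finset.prod_const, Finset.card_univ,
          Finset.card_univ, Fintype.card_fin, nsmul_eq_mul]
        ring
    _ ≤ _ := by
        gcongr
        linarith

/-- Finitely many tuples of basis vectors control the norm, and each entry is a member of the
derivative family. -/
theorem eventually_norm_iteratedFDeriv_le [FiniteDimensional ℝ S]
    (hF : ∀ i, ContDiff ℝ ∞ (F i)) (D : E →L[ℝ] S) {k : ℕ}
    (h : ∀ G, DerivFamily F k G → UnifSmall l K (fun i e => G i (D e))) {ε : ℝ} (hε : 0 < ε) :
    ∀ᶠ i in l, ∀ e ∈ K, ‖iteratedFDeriv ℝ k (F i) (D e)‖ ≤ ε := by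
  let b := Module.finBasis ℝ S
  obtain ⟨C, hC, hCT⟩ := exists_norm_multilinear_le b k
  have h1 : ∀ᶠ i in l, ∀ r : Fin k → Fin (Module.finrank ℝ S), ∀ e ∈ K,
      |iteratedFDeriv ℝ k (F i) (D e) (fun j => b (r j))| ≤ ε / C :=
    eventually_all.2 fun r => h _ (DerivFamily.iteratedFDeriv hF k _) _ (by positivity)
  filter_upwards [h1] with i hi e he
  refine (hCT _ (ε / C) (by positivity) fun r => hi r e he).trans_eq ?_
  field_simp

end DerivFamilies

/-! ### Limits of `C^n`-Cauchy sequences -/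

section Limits

open Filter Topology Set
open scoped ContDiff

/-- A pointwise limit of `C^n` functions which are uniformly Cauchy in `C^n` is `C^n`. -/
theorem contDiffOn_of_iteratedFDeriv_cauchy {S : Type} [NormedAddCommGroup S] [NormedSpace ℝ S]
    {U : Set S} (hU : IsOpen U) {n : ℕ} {W : Type} [NormedAddCommGroup W] [NormedSpace ℝ W]
    [CompleteSpace W] {F : ℕ → S → W} {G : S → W} (hF : ∀ k, ContDiff ℝ ∞ (F k))
    (hFG : ∀ x ∈ U, Tendsto (fun k => F k x) atTop (𝓝 (G x)))
    (hC : ∀ j ≤ n, ∀ ε > 0, ∀ᶠ p : ℕ × ℕ in atTop ×ˢ atTop, ∀ x ∈ U,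
      ‖iteratedFDeriv ℝ j (fun x => F p.1 x - F p.2 x) x‖ ≤ ε) :
    ContDiffOn ℝ n G U := by
  have h0 : ∀ {W : Type} [NormedAddCommGroup W] (F : ℕ → S → W) (G : S → W),
      (∀ x ∈ U, Tendsto (fun k => F k x) atTop (𝓝 (G x))) →
      (∀ ε > 0, ∀ᶠ p : ℕ × ℕ in atTop ×ˢ atTop, ∀ x ∈ U, ‖F p.1 x - F p.2 x‖ ≤ ε) →
      TendstoUniformlyOn F G atTop U := by
    intro W _ F G hFG hC
    refine UniformCauchySeqOn.tendstoUniformlyOn_of_tendsto ?_ hFG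
    rw [Metric.uniformCauchySeqOn_iff]
    intro ε hε
    have := hC (ε / 2) (by positivity)
    rw [prod_atTop_atTop_eq, eventually_atTop] at this
    obtain ⟨⟨a, b⟩, hab⟩ := this
    refine ⟨max a b, fun m hm k hk x hx => ?_⟩
    rw [dist_eq_norm]
    have := hab (m, k) ⟨(le_max_left a b).trans hm, (le_max_right a b).trans hk⟩ x hx
    simp only at this
    linarith
  -- The target space varies because the inductive step passes to `fderiv`, valued in `S →L[ℝ] W`.
  induction n generalizing W with
  | zero =>
    have hu := h0 F G hFG fun ε hε => by simpa using hC 0 le_rfl ε hε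
    rw [Nat.cast_zero, contDiffOn_zero]
    exact hu.continuousOn (Frequently.of_forall fun k => (hF k).continuous.continuousOn)
  | succ n ih =>
    have hd : ∀ k, Differentiable ℝ (F k) := fun k => (hF k).differentiable (by simp)
    have hsub : ∀ p : ℕ × ℕ, fderiv ℝ (fun x => F p.1 x - F p.2 x) =
        fun x => fderiv ℝ (F p.1) x - fderiv ℝ (F p.2) x := fun p => by
      ext1 x
      exact fderiv_fun_sub (hd _ x) (hd _ x)
    have hC1 : ∀ j ≤ n, ∀ ε > 0, ∀ᶠ p : ℕ × ℕ in atTop ×ˢ atTop, ∀ x ∈ U,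
        ‖iteratedFDeriv ℝ j (fun x => fderiv ℝ (F p.1) x - fderiv ℝ (F p.2) x) x‖ ≤ ε := by
      intro j hj ε hε
      filter_upwards [hC (j + 1) (by omega) ε hε] with p hp x hx
      rw [← hsub, norm_iteratedFDeriv_fderiv]
      exact hp x hx
    have hC10 : ∀ ε > 0, ∀ᶠ p : ℕ × ℕ in atTop ×ˢ atTop, ∀ x ∈ U,
        ‖fderiv ℝ (F p.1) x - fderiv ℝ (F p.2) x‖ ≤ ε := fun ε hε => by
      simpa using hC1 0 (Nat.zero_le _) ε hε
    have hlim : ∀ x ∈ U, ∃ L, Tendsto (fun k => fderiv ℝ (F k) x) atTop (𝓝 L) := by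
      intro x hx
      refine cauchySeq_tendsto_of_complete ?_
      rw [Metric.cauchySeq_iff]
      intro ε hε
      have := hC10 (ε / 2) (by positivity)
      rw [prod_atTop_atTop_eq, eventually_atTop] at this
      obtain ⟨⟨a, b⟩, hab⟩ := this
      refine ⟨max a b, fun m hm k hk => ?_⟩
      rw [dist_eq_norm]
      have := hab (m, k) ⟨(le_max_left a b).trans hm, (le_max_right a b).trans hk⟩ x hx
      simp only at this
      linarith
    choose! G' hG' using hlim
    have hu := h0 (fun k => fderiv ℝ (F k)) G' hG' hC10
    have hGd : ∀ x ∈ U, HasFDerivAt G (G' x) x := fun x hx =>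
      hasFDerivAt_of_tendstoUniformlyOn hU hu (fun k y _ => (hd k y).hasFDerivAt) hFG hx
    have hG'c : ContDiffOn ℝ n G' U := ih (fun k => (hF k).fderiv_right (by simp)) hG' hC1
    have := (contDiffOn_succ_iff_fderiv_of_isOpen (n := n) (f := G) (𝕜 := ℝ) hU).2
      ⟨fun x hx => (hGd x hx).differentiableAt.differentiableWithinAt, by simp,
        hG'c.congr fun x hx => (hGd x hx).fderiv⟩
    exact_mod_cast this

end Limits

/-! ### Density of polynomials in `C^n` -/

section PolynomialDensity

open Filter Topology Set MeasureTheory Metric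
open scoped ContDiff Convolution

theorem MvPolynomial.contDiff_eval {σ : Type*} [Fintype σ] {m : WithTop ℕ∞}
    (p : MvPolynomial σ ℝ) : ContDiff ℝ m (fun x : σ → ℝ => MvPolynomial.eval x p) := by
  induction p using MvPolynomial.induction_on with
  | C a => simpa using contDiff_const
  | add p q hp hq => simpa using hp.add hq
  | mul_X p i hp => simpa using hp.mul (contDiff_apply ℝ ℝ i)

/-- Stone–Weierstrass: the coordinate functions already separate points. -/
theorem MvPolynomial.exists_near_continuous {σ : Type*} [Fintype σ] {K : Set (σ → ℝ)}
    (hK : IsCompact K) {g : (σ → ℝ) → ℝ} (hg : Continuous g) {ε : ℝ} (hε : 0 < ε) :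
    ∃ q : MvPolynomial σ ℝ, ∀ x ∈ K, |MvPolynomial.eval x q - g x| ≤ ε := by
  have : CompactSpace K := isCompact_iff_compactSpace.1 hK
  let X : σ → C(K, ℝ) := fun i => ⟨fun x => x.1 i, (continuous_apply i).comp continuous_subtype_val⟩
  have hX : ∀ (q : MvPolynomial σ ℝ) (x : K), MvPolynomial.aeval X q x = MvPolynomial.eval x.1 q := by
    intro q x
    induction q using MvPolynomial.induction_on with
    | C a => simp
    | add p q hp hq => simp [hp, hq]
    | mul_X p i hp => simp [hp, X]
  have hsep : (MvPolynomial.aeval X : MvPolynomial σ ℝ →ₐ[ℝ] C(K, ℝ)).range.SeparatesPoints := by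
    intro x y hxy
    obtain ⟨i, hi⟩ : ∃ i, x.1 i ≠ y.1 i := by
      by_contra! h
      exact hxy (Subtype.ext (_root_.funext h))
    exact ⟨X i, ⟨X i, ⟨MvPolynomial.X i, by simp⟩, rfl⟩, hi⟩
  obtain ⟨⟨_, q, rfl⟩, hq⟩ :=
    ContinuousMap.exists_mem_subalgebra_near_continuous_of_separatesPoints _ hsep
      (fun x : K => g x) (by fun_prop) ε hε
  exact ⟨q, fun x hx => by simpa [hX] using (hq ⟨x, hx⟩).le⟩

variable {σ : Type*} [Fintype σ]

/-- The convolution of a polynomial with a compactly supported function is a polynomial. -/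
theorem MvPolynomial.exists_eval_eq_integral (q : MvPolynomial σ ℝ) {h : (σ → ℝ) → ℝ}
    (hc : Continuous h) (hs : HasCompactSupport h) :
    ∃ p : MvPolynomial σ ℝ, ∀ x, MvPolynomial.eval x p =
      ∫ t, MvPolynomial.eval (x - t) q * h t := by
  have hcont : ∀ q : MvPolynomial σ ℝ, Continuous (fun x : σ → ℝ => MvPolynomial.eval x q) :=
    fun q => (q.contDiff_eval (m := 0)).continuous
  have hint : ∀ (q : MvPolynomial σ ℝ) {h : (σ → ℝ) → ℝ}, Continuous h → HasCompactSupport h →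
      ∀ x, Integrable (fun t => MvPolynomial.eval (x - t) q * h t) := fun q h hc hs x =>
    (((hcont q).comp (by fun_prop)).mul hc).integrable_of_hasCompactSupport hs.mul_left
  -- Multiplying by a variable uses `x_i - t_i`: the `t_i` is absorbed into `h`, which must
  -- therefore vary.
  induction q using MvPolynomial.induction_on generalizing h with
  | C a => exact ⟨MvPolynomial.C (a * ∫ t, h t), fun x => by simp [integral_const_mul]⟩
  | add p q hp hq =>
    obtain ⟨p', hp'⟩ := hp hc hs
    obtain ⟨q', hq'⟩ := hq hc hs
    refine ⟨p' + q', fun x => ?_⟩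
    simp only [map_add, add_mul, hp', hq']
    rw [integral_add (hint p hc hs x) (hint q hc hs x)]
  | mul_X p i hp =>
    obtain ⟨p', hp'⟩ := hp hc hs
    have hc' : Continuous fun t : σ → ℝ => t i * h t := (continuous_apply i).mul hc
    have hs' : HasCompactSupport fun t : σ → ℝ => t i * h t := hs.mul_left
    obtain ⟨q', hq'⟩ := hp hc' hs'
    refine ⟨MvPolynomial.X i * p' - q', fun x => ?_⟩
    simp only [map_sub, map_mul, MvPolynomial.eval_X, hp', hq']
    rw [← integral_const_mul, ← integral_sub ((hint p hc hs x).const_mul _) (hint p hc' hs' x)]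
    refine integral_congr_ae (.of_forall fun t => ?_)
    simp only [Pi.sub_apply]
    ring

theorem dirDeriv_convolution {q h : (σ → ℝ) → ℝ} (hq : Continuous q) (hh : ContDiff ℝ 1 h)
    (hs : HasCompactSupport h) (v : σ → ℝ) :
    dirDeriv v (q ⋆[ContinuousLinearMap.lsmul ℝ ℝ] h) =
      q ⋆[ContinuousLinearMap.lsmul ℝ ℝ] (dirDeriv v h) := by
  ext x
  rw [dirDeriv, (hs.hasFDerivAt_convolution_right _ hq.locallyIntegrable hh x).fderiv]
  exact convolution_precompR_apply _ hq.locallyIntegrable (hs.fderiv ℝ)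
    (hh.continuous_fderiv one_ne_zero) x v

/-- Split the error as `(q - φ) ⋆ h` plus `φ ⋆ h - h`. The first is at most `∫ |h| / (k + 1)`, since
`x - t` stays in the ball of radius `A + R`; the second is small by uniform continuity of `h`. -/
theorem unifSmall_convolution_sub {A R : ℝ} {q : ℕ → (σ → ℝ) → ℝ} (hq : ∀ k, Continuous (q k))
    {φ : ℕ → ContDiffBump (0 : σ → ℝ)} (hφ : Tendsto (fun k => (φ k).rOut) atTop (𝓝 0))
    (hqφ : ∀ k, ∀ x ∈ closedBall (0 : σ → ℝ) (A + R),
      |q k x - (φ k).normed volume x| ≤ 1 / ((k : ℝ) + 1))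
    {h : (σ → ℝ) → ℝ} (hc : Continuous h) (hs : tsupport h ⊆ closedBall 0 R) :
    UnifSmall atTop (closedBall 0 A)
      (fun k x => (q k ⋆[ContinuousLinearMap.lsmul ℝ ℝ] h) x - h x) := by
  have hsc : HasCompactSupport h := (isCompact_closedBall _ _).of_isClosed_subset
    (isClosed_tsupport _) hs
  have hint : Integrable h := hc.integrable_of_hasCompactSupport hsc
  intro ε hε
  obtain ⟨δ, hδ, hδh⟩ := Metric.uniformContinuous_iff.1
    (hsc.uniformContinuous_of_continuous hc) (ε / 2) (by positivity)
  have h1 : ∀ᶠ k in atTop, (φ k).rOut < δ := hφ.eventually_lt_const hδ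
  have h2 : ∀ᶠ k : ℕ in atTop, 1 / ((k : ℝ) + 1) * ∫ t, |h t| < ε / 2 := by
    refine Tendsto.eventually_lt_const (v := 0) (by positivity) ?_
    simpa using (tendsto_one_div_add_atTop_nhds_zero_nat (𝕜 := ℝ)).mul_const (∫ t, |h t|)
  filter_upwards [h1, h2] with k hk1 hk2 x hx
  have e1 : |((φ k).normed volume ⋆[ContinuousLinearMap.lsmul ℝ ℝ] h) x - h x| ≤ ε / 2 := by
    rw [← Real.dist_eq]
    refine (φ k).dist_normed_convolution_le hc.aestronglyMeasurable fun y hy => ?_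
    exact (hδh ((mem_ball.1 hy).trans hk1)).le
  have hi : ∀ g : (σ → ℝ) → ℝ, Continuous g → Integrable (fun t => g (x - t) • h t) :=
    fun g hg => ((hg.comp (by fun_prop)).smul hc).integrable_of_hasCompactSupport hsc.smul_left
  have e2 : |(q k ⋆[ContinuousLinearMap.lsmul ℝ ℝ] h) x -
      ((φ k).normed volume ⋆[ContinuousLinearMap.lsmul ℝ ℝ] h) x| ≤ ε / 2 := by
    rw [convolution_eq_swap, convolution_eq_swap]
    simp only [ContinuousLinearMap.lsmul_apply]
    rw [← integral_sub (hi _ (hq k)) (hi _ (φ k).continuous_normed), ← Real.norm_eq_abs]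
    refine le_trans ?_ hk2.le
    rw [← integral_const_mul]
    refine norm_integral_le_of_norm_le (hint.abs.const_mul _) (.of_forall fun t => ?_)
    rw [← sub_smul, norm_smul, Real.norm_eq_abs, Real.norm_eq_abs]
    by_cases ht : h t = 0
    · simp [ht]
    · have htR : t ∈ closedBall (0 : σ → ℝ) R := hs (subset_tsupport _ ht)
      gcongr
      refine hqφ k _ ?_
      rw [mem_closedBall_zero_iff] at hx htR ⊢
      exact (norm_sub_le _ _).trans (add_le_add hx htR)
  have := abs_add_le ((q k ⋆[ContinuousLinearMap.lsmul ℝ ℝ] h) x -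
      ((φ k).normed volume ⋆[ContinuousLinearMap.lsmul ℝ ℝ] h) x)
      (((φ k).normed volume ⋆[ContinuousLinearMap.lsmul ℝ ℝ] h) x - h x)
  rw [sub_add_sub_cancel] at this
  linarith

/-- Derivatives fall on `h`, keeping its support in the ball, so uniform closeness of `q` to the
mollifier suffices at every order. -/
theorem csmall_convolution_sub {A R : ℝ} {q : ℕ → (σ → ℝ) → ℝ} (hq : ∀ k, Continuous (q k))
    {φ : ℕ → ContDiffBump (0 : σ → ℝ)} (hφ : Tendsto (fun k => (φ k).rOut) atTop (𝓝 0))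
    (hqφ : ∀ k, ∀ x ∈ closedBall (0 : σ → ℝ) (A + R),
      |q k x - (φ k).normed volume x| ≤ 1 / ((k : ℝ) + 1)) (m : ℕ)
    {h : (σ → ℝ) → ℝ} (hc : ContDiff ℝ m h) (hs : tsupport h ⊆ closedBall 0 R) :
    CSmall atTop (closedBall 0 A) m
      (fun k x => (q k ⋆[ContinuousLinearMap.lsmul ℝ ℝ] h) x - h x) := by
  induction m generalizing h with
  | zero => exact unifSmall_convolution_sub hq hφ hqφ hc.continuous hs
  | succ m ih =>
    refine ⟨unifSmall_convolution_sub hq hφ hqφ hc.continuous hs, fun v => ?_⟩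
    have hsc : HasCompactSupport h := (isCompact_closedBall _ _).of_isClosed_subset
      (isClosed_tsupport _) hs
    have hc1 : ContDiff ℝ 1 h := hc.of_le (by simp)
    have hsv' : Function.support (dirDeriv v h) ⊆ tsupport h := fun x hx =>
      support_fderiv_subset ℝ (f := h) (Function.mem_support.2 fun h0 =>
        Function.mem_support.1 hx (by simp [dirDeriv, h0]))
    have hsv : tsupport (dirDeriv v h) ⊆ closedBall 0 R :=
      (closure_minimal hsv' (isClosed_tsupport _)).trans hs
    convert ih (ContDiff.dirDeriv (by exact_mod_cast hc) v) hsv using 2 with k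
    rw [← dirDeriv_convolution (hq k) hc1 hsc]
    ext x
    have h1 : HasFDerivAt (q k ⋆[ContinuousLinearMap.lsmul ℝ ℝ] h) _ x :=
      hsc.hasFDerivAt_convolution_right _ (hq k).locallyIntegrable hc1 x
    simp only [dirDeriv]
    rw [fderiv_fun_sub h1.differentiableAt (hc1.differentiable one_ne_zero x)]
    rfl

/-- Polynomials are dense in `C^n` on a ball. -/
theorem exists_mvPolynomial_csmall_sub {n : ℕ} {f : (σ → ℝ) → ℝ} (hf : ContDiff ℝ n f) {A : ℝ}
    (hA : 0 ≤ A) : ∃ p : ℕ → MvPolynomial σ ℝ,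
      CSmall atTop (closedBall 0 A) n (fun k x => MvPolynomial.eval x (p k) - f x) := by
  -- The cutoff is `1` on a neighbourhood of the ball of radius `A`, so derivatives of `χ f` and `f`
  -- agree on that ball.
  let χ : ContDiffBump (0 : σ → ℝ) := ⟨A + 1, A + 2, by linarith, by linarith⟩
  let φ : ℕ → ContDiffBump (0 : σ → ℝ) := fun k =>
    ⟨1 / ((k : ℝ) + 1) / 2, 1 / ((k : ℝ) + 1), by positivity, half_lt_self (by positivity)⟩
  have hφ : Tendsto (fun k => (φ k).rOut) atTop (𝓝 0) := tendsto_one_div_add_atTop_nhds_zero_nat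
  have hq : ∀ k : ℕ, ∃ q : MvPolynomial σ ℝ, ∀ x ∈ closedBall (0 : σ → ℝ) (A + (A + 2)),
      |MvPolynomial.eval x q - (φ k).normed volume x| ≤ 1 / ((k : ℝ) + 1) := fun k =>
    MvPolynomial.exists_near_continuous (isCompact_closedBall _ _) (φ k).continuous_normed
      (by positivity)
  choose q hq using hq
  let h : (σ → ℝ) → ℝ := fun x => χ x * f x
  have hh : ContDiff ℝ n h := χ.contDiff.mul hf
  have hs : tsupport h ⊆ closedBall 0 (A + 2) := by
    have := tsupport_mul_subset_left (f := χ) (g := f)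
    rwa [χ.tsupport_eq] at this
  have hsc : HasCompactSupport h := (isCompact_closedBall _ _).of_isClosed_subset
    (isClosed_tsupport _) hs
  have hp := fun k => (q k).exists_eval_eq_integral hh.continuous hsc
  choose p hp using hp
  refine ⟨p, CSmall.congr_of_isOpen (isOpen_ball (x := (0 : σ → ℝ)) (ε := A + 1))
    (closedBall_subset_ball (by linarith)) (fun k x hx => ?_)
    (csmall_convolution_sub (fun k => ((q k).contDiff_eval (m := 0)).continuous) hφ hq n hh hs)⟩
  rw [hp, convolution_eq_swap]
  have : h x = f x := by
    simp [h, χ.one_of_mem_closedBall (ball_subset_closedBall hx)]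
  rw [this]
  rfl

end PolynomialDensity

/-! ### Symmetric polynomial approximation -/

section SymmetricPolynomials

open Filter Topology Set Metric
open scoped ContDiff

theorem MvPolynomial.isSymmetric_sum_rename {σ R : Type*} [Fintype σ] [DecidableEq σ]
    [CommSemiring R] (p : MvPolynomial σ R) :
    (∑ e : Equiv.Perm σ, MvPolynomial.rename e p).IsSymmetric := by
  intro s
  rw [map_sum]
  refine Fintype.sum_equiv (Equiv.mulLeft s) _ _ fun e => ?_
  rw [MvPolynomial.rename_rename]
  rfl

/-- Average the approximants over all permutations: these preserve both `f` and the sup-norm ball.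
-/
theorem exists_isSymmetric_csmall_sub {σ : Type*} [Fintype σ] [DecidableEq σ] {n : ℕ}
    {f : (σ → ℝ) → ℝ} (hf : ContDiff ℝ n f)
    (hsymm : ∀ (e : Equiv.Perm σ) x, f (x ∘ e) = f x) {A : ℝ} (hA : 0 ≤ A) :
    ∃ p : ℕ → MvPolynomial σ ℝ, (∀ k, (p k).IsSymmetric) ∧
      CSmall atTop (closedBall 0 A) n (fun k x => MvPolynomial.eval x (p k) - f x) := by
  obtain ⟨p, hp⟩ := exists_mvPolynomial_csmall_sub hf hA
  set c : ℝ := (Fintype.card (Equiv.Perm σ) : ℝ)⁻¹ with hc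
  have hc1 : c * Fintype.card (Equiv.Perm σ) = 1 := inv_mul_cancel₀ (by
    exact_mod_cast Fintype.card_ne_zero)
  refine ⟨fun k => c • ∑ e : Equiv.Perm σ, MvPolynomial.rename e (p k),
    fun k => (MvPolynomial.isSymmetric_sum_rename (p k)).smul c, ?_⟩
  have hpd : ∀ k, ContDiff ℝ n (fun x => MvPolynomial.eval x (p k) - f x) := fun k =>
    (p k).contDiff_eval.sub hf
  let L : Equiv.Perm σ → ((σ → ℝ) ≃L[ℝ] (σ → ℝ)) := fun e =>
    (LinearEquiv.funCongrLeft ℝ ℝ e).toContinuousLinearEquiv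
  have hL : ∀ e x, L e x = x ∘ e := fun e x => rfl
  have hLK : ∀ e, ∀ x ∈ closedBall (0 : σ → ℝ) A, L e x ∈ closedBall (0 : σ → ℝ) A := by
    intro e x hx
    rw [mem_closedBall_zero_iff, pi_norm_le_iff_of_nonneg hA] at hx ⊢
    exact fun i => hx (e i)
  have key := (CSmall.sum Finset.univ (fun e _ => hp.comp_equiv (L e) (hLK e))
    (fun e _ k => (hpd k).comp (L e).contDiff)).const_mul
      (fun k => ContDiff.sum fun e _ => (hpd k).comp (L e).contDiff) c
  convert key using 3 with k x
  simp only [hL, hsymm, Finset.sum_sub_distrib, Finset.sum_const, Finset.card_univ, nsmul_eq_mul,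
    mul_sub, ← mul_assoc, hc1, one_mul, MvPolynomial.smul_eval, map_sum,
    MvPolynomial.eval_rename]

end SymmetricPolynomials

/-! ### Invariant extensions through the characteristic polynomial -/

section CyclicFunctions

open scoped ContDiff

variable {d : ℕ}

theorem Matrix.contDiff_charpoly_coeff (k : ℕ) :
    ContDiff ℝ ∞ (fun M : Matrix (Fin d) (Fin d) ℝ => M.charpoly.coeff k) := by
  have h1 : ∀ M : Matrix (Fin d) (Fin d) ℝ, M.charpoly.coeff k = MvPolynomial.eval
      (fun ij : Fin d × Fin d => M ij.1 ij.2) ((Matrix.charpoly.univ ℝ (Fin d)).coeff k) := by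
    intro M
    have := Matrix.charpoly.univ_coeff_eval₂Hom (Fin d) (RingHom.id ℝ)
      (fun ij : Fin d × Fin d => M ij.1 ij.2) k
    exact this.symm
  simp only [h1]
  refine (MvPolynomial.contDiff_eval _).comp (contDiff_pi.2 fun ij => ?_)
  exact (LinearMap.toContinuousLinearMap (Matrix.entryLinearMap ℝ ℝ ij.1 ij.2)).contDiff

theorem Matrix.charpoly_diagonal_coeff (v : Fin d → ℝ) {k : ℕ} (hk : k ≤ d) :
    (-1) ^ k * (Matrix.diagonal v).charpoly.coeff (d - k) =
      MvPolynomial.eval v (MvPolynomial.esymm (Fin d) ℝ k) := by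
  rw [Matrix.charpoly_diagonal]
  have h1 : (∏ i, (Polynomial.X - Polynomial.C (v i))) =
      (Multiset.map (fun t => Polynomial.X - Polynomial.C t)
        (Finset.univ.val.map v)).prod := by
    rw [Multiset.map_map]
    rfl
  have hcard : Multiset.card (Finset.univ.val.map v) = d := by simp
  rw [h1, Multiset.prod_X_sub_C_coeff _ (by rw [hcard]; omega), hcard,
    show d - (d - k) = k by omega, ← mul_assoc, ← mul_pow]
  simp only [mul_neg, mul_one, neg_neg, one_pow, one_mul]
  rw [← MvPolynomial.aeval_esymm_eq_multiset_esymm (Fin d) ℝ, MvPolynomial.aeval_eq_eval]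

/-- A symmetric polynomial extends from the diagonal matrices to a smooth function of all
matrices which takes the same value at `A * B` and `B * A`. -/
theorem MvPolynomial.IsSymmetric.exists_matrix_extension {p : MvPolynomial (Fin d) ℝ}
    (hp : p.IsSymmetric) : ∃ P : Matrix (Fin d) (Fin d) ℝ → ℝ, ContDiff ℝ ∞ P ∧
      (∀ A B, P (A * B) = P (B * A)) ∧
      ∀ v, P (Matrix.diagonal v) = MvPolynomial.eval v p := by
  -- By the fundamental theorem on symmetric polynomials `p = Q(e_1, …, e_d)`; the extension
  -- replaces each `e_i` by a signed characteristic polynomial coefficient.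
  obtain ⟨Q, hQ⟩ := MvPolynomial.esymmAlgHom_surjective (σ := Fin d) ℝ (n := d) (by simp)
    ⟨p, hp⟩
  have hQ' : MvPolynomial.aeval (fun i : Fin d => MvPolynomial.esymm (Fin d) ℝ (i + 1)) Q = p := by
    rw [← MvPolynomial.esymmAlgHom_apply, hQ]
  refine ⟨fun M => MvPolynomial.eval
    (fun i : Fin d => (-1) ^ ((i : ℕ) + 1) * M.charpoly.coeff (d - (i + 1))) Q, ?_, ?_, ?_⟩
  · exact (MvPolynomial.contDiff_eval _).comp (contDiff_pi.2 fun i =>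
      contDiff_const.mul (Matrix.contDiff_charpoly_coeff _))
  · intro A B
    simp only [Matrix.charpoly_mul_comm A B]
  · intro v
    simp only [Matrix.charpoly_diagonal_coeff v (Nat.succ_le_of_lt (Fin.is_lt _))]
    have h := MvPolynomial.comp_aeval_apply
      (f := fun i : Fin d => MvPolynomial.esymm (Fin d) ℝ (i + 1)) (MvPolynomial.aeval v) Q
    rw [hQ'] at h
    simpa only [MvPolynomial.aeval_eq_eval] using h.symm

/-- Differentiate `P((1 + tξ) x) = P(x (1 + tξ))` at `t = 0`; cyclicity avoids any matrix
exponential. -/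
theorem fderiv_commutator_eq_zero {P : Matrix (Fin d) (Fin d) ℝ → ℝ} (hP : Differentiable ℝ P)
    (hcyc : ∀ A B, P (A * B) = P (B * A)) (ξ x : Matrix (Fin d) (Fin d) ℝ) :
    fderiv ℝ P x (ξ * x - x * ξ) = 0 := by
  have h1 := (hP x).hasFDerivAt.hasLineDerivAt (ξ * x)
  have h2 := (hP x).hasFDerivAt.hasLineDerivAt (x * ξ)
  have h3 : (fun t : ℝ => P (x + t • (ξ * x))) = fun t => P (x + t • (x * ξ)) := by
    ext t
    have := hcyc (1 + t • ξ) x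
    simpa [add_mul, mul_add] using this
  rw [HasLineDerivAt, h3] at h1
  rw [map_sub]
  exact sub_eq_zero.2 (h1.unique h2)

end CyclicFunctions

/-! ### Orthogonal conjugation and diagonalisation -/

section OrthogonalConjugation

open Matrix

variable {d : ℕ}

theorem frobenius_norm_sq_eq_trace (A : Matrix (Fin d) (Fin d) ℝ) : ‖A‖ ^ 2 = (Aᵀ * A).trace := by
  rw [Matrix.frobenius_norm_def, ← Real.sqrt_eq_rpow, Real.sq_sqrt (by positivity),
    Finset.sum_comm]
  simp [Matrix.trace, Matrix.mul_apply, sq]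

/-- Conjugation by an orthogonal matrix as a linear isometry of the symmetric matrices. -/
noncomputable def orthoConj (g : orthogonalGroup (Fin d) ℝ) :
    symMatrices d ≃ₗᵢ[ℝ] symMatrices d where
  toFun x := ⟨(g : Matrix (Fin d) (Fin d) ℝ) * x * (g : Matrix (Fin d) (Fin d) ℝ)ᵀ, by
    have hx : (x : Matrix (Fin d) (Fin d) ℝ)ᵀ = x := x.2
    change Matrix.transpose _ = _
    simp [hx, mul_assoc]⟩
  invFun x := ⟨(g : Matrix (Fin d) (Fin d) ℝ)ᵀ * x * g, by
    have hx : (x : Matrix (Fin d) (Fin d) ℝ)ᵀ = x := x.2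
    change Matrix.transpose _ = _
    simp [hx, mul_assoc]⟩
  map_add' x y := by ext1; simp [mul_add, add_mul]
  map_smul' c x := by ext1; simp
  left_inv x := by
    have hg : (g : Matrix (Fin d) (Fin d) ℝ)ᵀ * g = 1 := (mem_orthogonalGroup_iff' _ _).1 g.2
    ext1
    simp only
    calc (g : Matrix (Fin d) (Fin d) ℝ)ᵀ * (g * x * (g : Matrix (Fin d) (Fin d) ℝ)ᵀ) * g
        = ((g : Matrix (Fin d) (Fin d) ℝ)ᵀ * g) * x * ((g : Matrix (Fin d) (Fin d) ℝ)ᵀ * g) := by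
          simp only [mul_assoc]
      _ = x := by rw [hg, one_mul, mul_one]
  right_inv x := by
    have hg : (g : Matrix (Fin d) (Fin d) ℝ) * (g : Matrix (Fin d) (Fin d) ℝ)ᵀ = 1 :=
      (mem_orthogonalGroup_iff _ _).1 g.2
    ext1
    simp only
    calc (g : Matrix (Fin d) (Fin d) ℝ) * ((g : Matrix (Fin d) (Fin d) ℝ)ᵀ * x * g) *
          (g : Matrix (Fin d) (Fin d) ℝ)ᵀ
        = (g * (g : Matrix (Fin d) (Fin d) ℝ)ᵀ) * x * (g * (g : Matrix (Fin d) (Fin d) ℝ)ᵀ) := by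
          simp only [mul_assoc]
      _ = x := by rw [hg, one_mul, mul_one]
  norm_map' x := by
    have hg : (g : Matrix (Fin d) (Fin d) ℝ)ᵀ * g = 1 := (mem_orthogonalGroup_iff' _ _).1 g.2
    refine (sq_eq_sq₀ (norm_nonneg _) (norm_nonneg _)).1 ?_
    change ‖(g : Matrix (Fin d) (Fin d) ℝ) * x * (g : Matrix (Fin d) (Fin d) ℝ)ᵀ‖ ^ 2 =
      ‖(x : Matrix (Fin d) (Fin d) ℝ)‖ ^ 2
    rw [frobenius_norm_sq_eq_trace, frobenius_norm_sq_eq_trace]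
    simp only [transpose_mul, transpose_transpose]
    calc _ = ((g : Matrix (Fin d) (Fin d) ℝ) * ((x : Matrix (Fin d) (Fin d) ℝ)ᵀ *
          (((g : Matrix (Fin d) (Fin d) ℝ)ᵀ * g) * x) *
            (g : Matrix (Fin d) (Fin d) ℝ)ᵀ)).trace := by simp only [mul_assoc]
      _ = _ := by rw [hg, one_mul, trace_mul_comm, mul_assoc, hg, mul_one]

@[simp]
theorem coe_orthoConj (g : orthogonalGroup (Fin d) ℝ) (x : symMatrices d) :
    (orthoConj g x : Matrix (Fin d) (Fin d) ℝ) =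
      (g : Matrix (Fin d) (Fin d) ℝ) * x * (g : Matrix (Fin d) (Fin d) ℝ)ᵀ := rfl

/-- The embedding of vectors as diagonal matrices. -/
noncomputable def diagEmb (d : ℕ) : (Fin d → ℝ) →L[ℝ] symMatrices d :=
  LinearMap.toContinuousLinearMap
    { toFun := fun v => ⟨diagonal v, isSymm_diagonal v⟩
      map_add' := fun v w => by ext1; simp
      map_smul' := fun c v => by ext1; simp }

@[simp]
theorem coe_diagEmb (v : Fin d → ℝ) :
    (diagEmb d v : Matrix (Fin d) (Fin d) ℝ) = diagonal v := rfl

theorem norm_le_norm_diagEmb (v : Fin d → ℝ) : ‖v‖ ≤ ‖diagEmb d v‖ := by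
  change _ ≤ ‖diagonal v‖
  rw [frobenius_norm_diagonal]
  refine (pi_norm_le_iff_of_nonneg (norm_nonneg _)).2 fun i => ?_
  exact PiLp.norm_apply_le (WithLp.toLp 2 v) i

theorem exists_eq_orthoConj_diagEmb (x : symMatrices d) :
    ∃ (g : orthogonalGroup (Fin d) ℝ) (v : Fin d → ℝ), x = orthoConj g (diagEmb d v) := by
  have hx : (x : Matrix (Fin d) (Fin d) ℝ).IsHermitian := by
    have : (x : Matrix (Fin d) (Fin d) ℝ)ᵀ = x := x.2
    rw [Matrix.IsHermitian, conjTranspose_eq_transpose_of_trivial, this]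
  refine ⟨hx.eigenvectorUnitary, hx.eigenvalues, ?_⟩
  ext1
  have := hx.spectral_theorem
  rw [Unitary.conjStarAlgAut_apply] at this
  exact this

theorem RotationInvariant.orthoConj_diagEmb {F : symMatrices d → ℝ} (hF : RotationInvariant F)
    (g : orthogonalGroup (Fin d) ℝ) (v : Fin d → ℝ) :
    F (orthoConj g (diagEmb d v)) = F (diagEmb d v) := by
  have hrot : ∀ h : Matrix (Fin d) (Fin d) ℝ, h ∈ orthogonalGroup (Fin d) ℝ → h.det = 1 →
      h * diagonal v * hᵀ = g * diagonal v * (g : Matrix (Fin d) (Fin d) ℝ)ᵀ →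
      F (orthoConj g (diagEmb d v)) = F (diagEmb d v) := by
    intro h ho hd hh
    rw [← hF ⟨h, mem_specialOrthogonalGroup_iff.2 ⟨ho, hd⟩⟩ (diagEmb d v)]
    congr 1
    ext1
    exact hh.symm
  have hg := (mem_orthogonalGroup_iff _ _).1 g.2
  have hdet : (g : Matrix (Fin d) (Fin d) ℝ).det = 1 ∨ (g : Matrix (Fin d) (Fin d) ℝ).det = -1 := by
    have := congrArg det hg
    rw [det_mul, det_transpose, det_one] at this
    exact mul_self_eq_one_iff.1 this
  rcases hdet with hdet | hdet
  · exact hrot g g.2 hdet rfl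
  · rcases Nat.eq_zero_or_pos d with rfl | hd
    · rw [det_fin_zero] at hdet
      norm_num at hdet
    -- A reflection in one coordinate fixes `diagonal v` under conjugation, so it corrects the
    -- determinant of `g` for free.
    let w : Fin d → ℝ := Function.update 1 ⟨0, hd⟩ (-1)
    have hw : ∀ i, w i * w i = 1 := by
      intro i
      by_cases hi : i = ⟨0, hd⟩
      · subst hi; simp [w]
      · simp [w, Function.update_of_ne hi]
    have hww : diagonal w * diagonal w = 1 := by
      rw [diagonal_mul_diagonal]
      simp only [hw, diagonal_one]
    have hwo : diagonal w ∈ orthogonalGroup (Fin d) ℝ := by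
      rw [mem_orthogonalGroup_iff, diagonal_transpose]
      exact hww
    refine hrot (g * diagonal w) (mul_mem g.2 hwo) ?_ ?_
    · rw [det_mul, hdet, det_diagonal, Finset.prod_update_of_mem (Finset.mem_univ _)]
      simp
    · have hwv : diagonal w * diagonal v * diagonal w = diagonal v := by
        rw [diagonal_mul_diagonal, diagonal_mul_diagonal]
        congr 1
        ext i
        rw [mul_right_comm, hw, one_mul]
      rw [transpose_mul, diagonal_transpose]
      calc _ = (g : Matrix (Fin d) (Fin d) ℝ) * (diagonal w * diagonal v * diagonal w) *
            (g : Matrix (Fin d) (Fin d) ℝ)ᵀ := by simp only [mul_assoc]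
        _ = _ := by rw [hwv]

/-- Conjugation by a permutation matrix permutes the diagonal entries. -/
theorem RotationInvariant.diagEmb_comp_perm {F : symMatrices d → ℝ} (hF : RotationInvariant F)
    (e : Equiv.Perm (Fin d)) (v : Fin d → ℝ) : F (diagEmb d (v ∘ e)) = F (diagEmb d v) := by
  let P : Matrix (Fin d) (Fin d) ℝ := (1 : Matrix (Fin d) (Fin d) ℝ).submatrix e id
  have hPT : Pᵀ = (1 : Matrix (Fin d) (Fin d) ℝ).submatrix id e := by
    simp [P, transpose_submatrix]
  have hmul : ∀ M : Matrix (Fin d) (Fin d) ℝ, P * M * Pᵀ = M.submatrix e e := by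
    intro M
    have h1 : P * M = M.submatrix e id := by
      have := submatrix_mul (1 : Matrix (Fin d) (Fin d) ℝ) M e id id Function.bijective_id
      simpa [P] using this.symm
    rw [h1, hPT]
    have := submatrix_mul M (1 : Matrix (Fin d) (Fin d) ℝ) e id e Function.bijective_id
    simpa using this.symm
  have hP : P ∈ orthogonalGroup (Fin d) ℝ := by
    rw [mem_orthogonalGroup_iff]
    have := hmul 1
    rwa [mul_one, submatrix_one_equiv] at this
  rw [← hF.orthoConj_diagEmb ⟨P, hP⟩ v]
  congr 1
  ext1
  simp [hmul, submatrix_diagonal_equiv]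

end OrthogonalConjugation

/-! ### Commutator fields on symmetric matrices -/

section SymmetricMatrixFields

open Matrix Set

variable {d : ℕ}

/-- The commutator with a skew-symmetric matrix as a vector field on symmetric matrices. -/
noncomputable def skewCommutator (ξ : Matrix (Fin d) (Fin d) ℝ) (hξ : ξᵀ = -ξ) :
    symMatrices d →L[ℝ] symMatrices d :=
  LinearMap.toContinuousLinearMap
    { toFun := fun x => ⟨ξ * x - x * ξ, by
        have hx : (x : Matrix (Fin d) (Fin d) ℝ)ᵀ = x := x.2
        change Matrix.transpose _ = _
        rw [transpose_sub, transpose_mul, transpose_mul, hx, hξ, mul_neg, neg_mul]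
        abel⟩
      map_add' := fun x y => by
        ext1
        change ξ * (x + y : Matrix (Fin d) (Fin d) ℝ) - (x + y : Matrix (Fin d) (Fin d) ℝ) * ξ =
          (ξ * x - x * ξ) + (ξ * y - y * ξ)
        rw [mul_add, add_mul]
        abel
      map_smul' := fun c x => by
        ext1
        change ξ * (c • x : Matrix (Fin d) (Fin d) ℝ) - (c • x : Matrix (Fin d) (Fin d) ℝ) * ξ =
          c • (ξ * x - x * ξ)
        rw [mul_smul_comm, smul_mul_assoc, smul_sub] }

@[simp]
theorem coe_skewCommutator (ξ : Matrix (Fin d) (Fin d) ℝ) (hξ : ξᵀ = -ξ) (x : symMatrices d) :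
    (skewCommutator ξ hξ x : Matrix (Fin d) (Fin d) ℝ) = ξ * x - x * ξ := rfl

/-- The symmetric matrix `E_ij + E_ji`. -/
noncomputable def symUnit (i j : Fin d) : symMatrices d :=
  ⟨single i j 1 + single j i 1, by
    change Matrix.transpose _ = _
    rw [transpose_add, transpose_single, transpose_single, add_comm]⟩

theorem span_range_symUnit :
    Submodule.span ℝ (range fun p : Fin d × Fin d => symUnit p.1 p.2) = ⊤ := by
  rw [eq_top_iff]
  rintro x -
  have hx : ∀ i j, (x : Matrix (Fin d) (Fin d) ℝ) i j = (x : Matrix (Fin d) (Fin d) ℝ) j i :=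
    fun i j => congrFun (congrFun (show (x : Matrix (Fin d) (Fin d) ℝ)ᵀ = x from x.2) j) i
  have : x = ∑ p : Fin d × Fin d, ((x : Matrix (Fin d) (Fin d) ℝ) p.1 p.2 / 2) •
      symUnit p.1 p.2 := by
    ext1
    have h1 := matrix_eq_sum_single (x : Matrix (Fin d) (Fin d) ℝ)
    have h2 : (x : Matrix (Fin d) (Fin d) ℝ) = ∑ i, ∑ j,
        single j i ((x : Matrix (Fin d) (Fin d) ℝ) i j) := by
      rw [Finset.sum_comm]
      simpa only [hx] using h1
    rw [Fintype.sum_prod_type]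
    push_cast
    have h3 : ∀ i j, (((x : Matrix (Fin d) (Fin d) ℝ) i j / 2) • (symUnit i j : Matrix (Fin d) (Fin d) ℝ)) =
        (1 / 2 : ℝ) • (single i j ((x : Matrix (Fin d) (Fin d) ℝ) i j) +
          single j i ((x : Matrix (Fin d) (Fin d) ℝ) i j)) := by
      intro i j
      simp only [symUnit, smul_add, smul_single, smul_eq_mul, mul_one]
      congr 2 <;> ring
    simp only [h3, ← Finset.smul_sum, Finset.sum_add_distrib]
    rw [← h1, ← h2, ← two_smul ℝ, smul_smul]
    norm_num
  rw [this]
  exact Submodule.sum_mem _ fun p _ => Submodule.smul_mem _ _ (Submodule.subset_span ⟨p, rfl⟩)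

theorem diagEmb_single (i : Fin d) : diagEmb d (Pi.single i 2) = symUnit i i := by
  ext1
  change Matrix.diagonal _ = single i i 1 + single i i 1
  rw [← single_add, diagonal_single]
  norm_num

theorem skewCommutator_diagEmb (i j : Fin d) (h : (single i j (1 : ℝ) - single j i 1)ᵀ =
    -(single i j (1 : ℝ) - single j i 1)) (v : Fin d → ℝ) :
    skewCommutator (single i j 1 - single j i 1) h (diagEmb d v) = (v j - v i) • symUnit i j := by
  ext a b
  rw [coe_skewCommutator, coe_diagEmb, Matrix.sub_apply, mul_diagonal, diagonal_mul]
  change _ = (v j - v i) * (single i j 1 + single j i 1 : Matrix (Fin d) (Fin d) ℝ) a b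
  simp only [Matrix.sub_apply, Matrix.add_apply, single_apply]
  split_ifs with h1 h2 h2
  · obtain ⟨rfl, rfl⟩ := h1
    rw [h2.1]
    ring
  · obtain ⟨rfl, rfl⟩ := h1
    ring
  · obtain ⟨rfl, rfl⟩ := h2
    ring
  · ring

/-- Only coordinates `i` and `j` move, each to a convex combination of `x i` and `x j`, which the
sup-norm ball allows. The factor `1 / 2` moves both towards their mean. -/
theorem sub_smul_mem_closedBall {i j : Fin d} {A : ℝ} (hA : 0 ≤ A) {x : Fin d → ℝ}
    (hx : x ∈ Metric.closedBall (0 : Fin d → ℝ) A) {t : ℝ} (ht : t ∈ Icc (0 : ℝ) 1) :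
    x - ((1 - t) * (x j - x i)) • ((1 / 2 : ℝ) • (Pi.single j 1 - Pi.single i 1 : Fin d → ℝ)) ∈
      Metric.closedBall (0 : Fin d → ℝ) A := by
  rw [mem_closedBall_zero_iff, pi_norm_le_iff_of_nonneg hA] at hx ⊢
  intro k
  have hi := abs_le.1 (hx i)
  have hj := abs_le.1 (hx j)
  have hk := abs_le.1 (hx k)
  obtain ⟨h0, h1⟩ := ht
  rw [Real.norm_eq_abs, abs_le]
  simp only [Pi.sub_apply, Pi.smul_apply, Pi.single_apply, smul_eq_mul]
  split_ifs with hkj hki hki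
  · subst hkj; simpa using hk
  · subst hkj; constructor <;> nlinarith
  · subst hki; constructor <;> nlinarith
  · simpa using hk

end SymmetricMatrixFields

/-! ### The a priori estimate and the conclusion -/

section MainTheorem

open Filter Topology Metric Set
open Matrix hiding diagonal
open scoped ContDiff

variable {d : ℕ}

theorem eventually_norm_iteratedFDeriv_le_of_csmall {ι : Type*} {l : Filter ι}
    {P : ι → Matrix (Fin d) (Fin d) ℝ → ℝ} (hP : ∀ i, ContDiff ℝ ∞ (P i))
    (hcyc : ∀ i A B, P i (A * B) = P i (B * A)) {R : ℝ} (hR : 0 ≤ R) {n : ℕ}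
    (h : CSmall l (closedBall 0 R) n (fun i v => P i (Matrix.diagonal v))) {k : ℕ} (hk : k ≤ n)
    {ε : ℝ} (hε : 0 < ε) :
    ∀ᶠ i in l, ∀ x ∈ closedBall (0 : symMatrices d) R,
      ‖iteratedFDeriv ℝ k (fun x : symMatrices d => P i x) x‖ ≤ ε := by
  set F : ι → symMatrices d → ℝ := fun i x => P i x with hFdef
  have hF : ∀ i, ContDiff ℝ ∞ (F i) := fun i => (hP i).comp (symMatrices d).subtypeL.contDiff
  have hFd : ∀ i x v, fderiv ℝ (F i) x v =
      fderiv ℝ (P i) x (v : Matrix (Fin d) (Fin d) ℝ) := by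
    intro i x v
    have h1 : HasFDerivAt (F i) _ x := (((hP i).differentiable (by simp)
      (x : Matrix (Fin d) (Fin d) ℝ)).hasFDerivAt).comp x (symMatrices d).subtypeL.hasFDerivAt
    rw [h1.fderiv]
    rfl
  have hBD : ∀ b ∈ range (fun p : Fin d × Fin d => symUnit p.1 p.2),
      (∃ e, diagEmb d e = b) ∨ ∃ (A : symMatrices d →L[ℝ] symMatrices d)
        (ℓ : (Fin d → ℝ) →L[ℝ] ℝ) (w : Fin d → ℝ), ℓ w = 1 ∧
      (∀ x ∈ closedBall (0 : Fin d → ℝ) R, ∀ t ∈ Icc (0 : ℝ) 1,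
        x - ((1 - t) * ℓ x) • w ∈ closedBall (0 : Fin d → ℝ) R) ∧
      (∀ i x, fderiv ℝ (F i) x (A x) = 0) ∧ ∀ e, A (diagEmb d e) = ℓ e • b := by
    rintro _ ⟨⟨i, j⟩, rfl⟩
    by_cases hij : i = j
    · subst hij
      exact Or.inl ⟨_, diagEmb_single i⟩
    · right
      have hξ : (single i j (1 : ℝ) - single j i 1)ᵀ = -(single i j (1 : ℝ) - single j i 1) := by
        rw [transpose_sub, transpose_single, transpose_single, neg_sub]
      obtain ⟨ℓ, hℓ⟩ : ∃ ℓ : (Fin d → ℝ) →L[ℝ] ℝ, ∀ v, ℓ v = v j - v i :=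
        ⟨ContinuousLinearMap.proj (R := ℝ) (φ := fun _ : Fin d => ℝ) j -
          ContinuousLinearMap.proj (R := ℝ) (φ := fun _ : Fin d => ℝ) i, fun v => rfl⟩
      refine ⟨skewCommutator _ hξ, ℓ, (1 / 2 : ℝ) • (Pi.single j 1 - Pi.single i 1), ?_,
        fun x hx t ht => ?_, fun p x => ?_, fun e => ?_⟩
      · rw [map_smul, hℓ, Pi.sub_apply, Pi.sub_apply, Pi.single_eq_same, Pi.single_eq_same,
          Pi.single_eq_of_ne hij, Pi.single_eq_of_ne (Ne.symm hij)]
        norm_num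
      · rw [hℓ]
        exact sub_smul_mem_closedBall hR hx ht
      · rw [hFd, coe_skewCommutator]
        exact fderiv_commutator_eq_zero ((hP p).differentiable (by simp)) (hcyc p) _ _
      · rw [hℓ]
        exact skewCommutator_diagEmb i j hξ e
  have hsmall := fun G (hG : DerivFamily F k G) =>
    (DerivFamily.csmall hF (diagEmb d) span_range_symUnit hBD h k 0 G (by omega) hG).unifSmall
  filter_upwards [eventually_norm_iteratedFDeriv_le hF (diagEmb d) hsmall hε] with i hi x hx
  -- The bound holds at diagonal points; invariance under the isometry `orthoConj g` transports it
  -- to `x`.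
  obtain ⟨g, v, rfl⟩ := exists_eq_orthoConj_diagEmb x
  have hinv : F i ∘ orthoConj g = F i := by
    ext x
    have hg : (g : Matrix (Fin d) (Fin d) ℝ)ᵀ * g = 1 := (mem_orthogonalGroup_iff' _ _).1 g.2
    change P i ((g : Matrix (Fin d) (Fin d) ℝ) * x * (g : Matrix (Fin d) (Fin d) ℝ)ᵀ) = P i x
    rw [hcyc, ← mul_assoc, hg, one_mul]
  rw [← (orthoConj g).norm_iteratedFDeriv_comp_right, hinv]
  refine hi v ?_
  rw [mem_closedBall_zero_iff, LinearIsometryEquiv.norm_map] at hx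
  exact mem_closedBall_zero_iff.2 ((norm_le_norm_diagEmb v).trans hx)

/-- The estimate is applied to the differences `P q.1 - P q.2`, which are smooth and cyclic, since
`F` itself is not yet known to be differentiable. -/
theorem RotationInvariant.contDiffOn_ball {F : symMatrices d → ℝ} (hF : RotationInvariant F)
    {n : ℕ} (hdiag : ContDiff ℝ n (fun v => F (diagEmb d v))) {R : ℝ} (hR : 0 ≤ R) :
    ContDiffOn ℝ n F (ball 0 R) := by
  obtain ⟨p, hp, hpf⟩ := exists_isSymmetric_csmall_sub hdiag hF.diagEmb_comp_perm hR
  choose P hP hcyc hPdiag using fun k => (hp k).exists_matrix_extension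
  have hpd : ∀ k, ContDiff ℝ n (fun v => MvPolynomial.eval v (p k) - F (diagEmb d v)) := fun k =>
    (p k).contDiff_eval.sub hdiag
  have hpp : CSmall ((atTop : Filter ℕ) ×ˢ (atTop : Filter ℕ)) (closedBall 0 R) n
      (fun q v => P q.1 (Matrix.diagonal v) - P q.2 (Matrix.diagonal v)) := by
    convert (hpf.comp_tendsto tendsto_fst).add ((hpf.comp_tendsto tendsto_snd).const_mul
      (fun q => hpd q.2) (-1)) (fun q => hpd q.1) (fun q => contDiff_const.mul (hpd q.2))
      using 3 with q v
    rw [hPdiag, hPdiag]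
    ring
  refine contDiffOn_of_iteratedFDeriv_cauchy isOpen_ball 
    (F := fun k (x : symMatrices d) => P k (x : Matrix (Fin d) (Fin d) ℝ))
    (fun k => (hP k).comp (symMatrices d).subtypeL.contDiff) (fun x hx => ?_)
    (fun j hj ε hε => ?_)
  · obtain ⟨g, v, rfl⟩ := exists_eq_orthoConj_diagEmb x
    rw [mem_ball_zero_iff, LinearIsometryEquiv.norm_map] at hx
    have hv : v ∈ closedBall (0 : Fin d → ℝ) R :=
      mem_closedBall_zero_iff.2 ((norm_le_norm_diagEmb v).trans hx.le)
    have hg : (g : Matrix (Fin d) (Fin d) ℝ)ᵀ * g = 1 := (mem_orthogonalGroup_iff' _ _).1 g.2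
    rw [hF.orthoConj_diagEmb, Metric.tendsto_nhds]
    intro ε hε
    filter_upwards [hpf.unifSmall (ε / 2) (by positivity)] with k hk
    have h1 := hk v hv
    rw [coe_orthoConj, hcyc, ← mul_assoc, hg, one_mul, coe_diagEmb, hPdiag, Real.dist_eq]
    linarith
  · have := eventually_norm_iteratedFDeriv_le_of_csmall
      (P := fun (q : ℕ × ℕ) M => P q.1 M - P q.2 M) (fun q => (hP q.1).sub (hP q.2))
      (fun q A B => by rw [hcyc q.1 A B, hcyc q.2 A B]) hR hpp hj hε
    filter_upwards [this] with q hq x hx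
    exact hq x (ball_subset_closedBall hx)

end MainTheorem

theorem theorem2 (d n : ℕ) (F : symMatrices d → ℝ) (hF : RotationInvariant F)
    (hdiag : ContDiff ℝ n (fun x : diagMatrices d => F (x : symMatrices d))) :
    ContDiff ℝ n F := by
  have hdiag' : ContDiff ℝ n (fun v => F (diagEmb d v)) :=
    hdiag.comp ((diagEmb d).codRestrict (diagMatrices d)
      fun v => Matrix.isDiag_diagonal v).contDiff
  rw [contDiff_iff_contDiffAt]
  intro x
  refine (hF.contDiffOn_ball hdiag' (R := ‖x‖ + 1) (by positivity)).contDiffAt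
    (Metric.isOpen_ball.mem_nhds ?_)
  rw [mem_ball_zero_iff]
  linarith
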